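/- **Theorem (First Fundamental Theorem of Calculus, point-free).** Spaces are locales, maps are locale maps (so every map is continuous), and real numbers are Dedekind reals. Notation and definitions: - For reals $x\le y$, the Lebesgue valuation $\lambda_{xy}$ on $[x,y]$ is the valuation with $\lambda_{xy}(a,b)=\max(0,\min(b,y)-\max(a,x))$ for all rationals $a<b$. The uniform valuation $\upsilon_{xy}$ on $[x,y]$ is the valuation for which, for rationals $a<b$ and $q\ge 0$, $q<\upsilon_{xy}(a,b)$ iff $q'(y-x)<\lambda_{xy}(a,b)$ or ($a<x$, $y<b$ and $q'<1$) for some rational $q'>q$. The mass of a general open is the supremum of the total masses of the finite families of pairwise disjoint rational open intervals contained in it (relative to $[x,y]$). - For a finite valuation $\mu$ on a compact space $X$ and a map $\varphi\colon X\to[0,\infty)$, the integral $\int_X\varphi\,d\mu$ is the Dedekind real whose lower part is the lower integral $\sup\sum_{i=1}^n(r_i-r_{i-1})\,\mu\bigl(\varphi^*(r_i,\infty)\bigr)$ and whose upper part is the upper integral $\inf\sum_{i=1}^n(r_i-r_{i-1})\bigl(\mu X-\mu\,\varphi^*[0,r_{i-1})\bigr)$; both range over the rational sequences $0=r_0<\dots<r_n$,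 $n\ge1$, for the upper integral only those with $\varphi^*[0,r_n)=X$. For $\varphi\colon X\to\mathbb R$, $\int_X\varphi\,d\mu=\int_X\max(0,\varphi)\,d\mu-\int_X\max(0,-\varphi)\,d\mu$. - $\int_x^y g(t)\,dt$ is $\int_{[x,y]}g\,d\lambda_{xy}$ if $x\le y$, and $-\int_{[y,x]}g\,d\lambda_{yx}$ if $y\le x$. - A map $f\colon I\to\mathbb R$ on an open interval $I$ is differentiable (in the sense of Carathéodory) with derivative $f'$ if there is a map $f^{\langle1\rangle}\colon I\times I\to\mathbb R$ (a slope map) such that, as maps on $I\times I$, $f(y)-f(x)=(y-x)\,f^{\langle1\rangle}(x,y)$, and $f'(x)=f^{\langle1\rangle}(x,x)$. Let $I$ be an open interval of $\mathbb R$ (bounded or not), $x_0$ a point of $I$, and $g\colon I\to\mathbb R$ a map. Then $f(x)=\int_{x_0}^x g(t)\,dt$ defines a unique map $f\colon I\to\mathbb R$, and $f$ is differentiable in the sense of Carathéodory with derivative $f'=g$. A slope map is given, uniformly for all points $x,y$ of $I$ (including $x=y$), by $$f^{\langle1\rangle}(x,y)=\int_{[x',y']}g\,d\upsilon_{x'y'},\qquad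 x'=\min(x,y),\quad y'=\max(x,y),$$ where $\upsilon_{x'y'}$ is a probability valuation and the integral exists as a Dedekind real. -/

import Mathlib

open TopologicalSpace
open scoped NNReal ENNReal

noncomputable section

namespace PointFree

/-! Point-free spaces (locales) and their maps. A map `X → Y` is a frame homomorphism from the
frame of opens of `Y` to the frame of opens of `X` (its inverse image). The locales of concern here,
namely the real line, its intervals and their finite products, are spatial and locally compact:
their frames are the lattices `Opens` of the corresponding topological spaces, and the product
space is the product locale. -/

/-- Maps of point-free spaces from `X` to `Y`, given by their inverse images on opens. -/
abbrev LMap (X Y : Type) [TopologicalSpace X] [TopologicalSpace Y] : Type :=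
  FrameHom (Opens Y) (Opens X)

/-- The map `f` takes the point `x` to the point `y`. -/
def LMap.HasValue {X Y : Type} [TopologicalSpace X] [TopologicalSpace Y]
    (f : LMap X Y) (x : X) (y : Y) : Prop :=
  ∀ U : Opens Y, x ∈ f U ↔ y ∈ U

/-- The composite `L → ℝ × ℝ → ℝ` of the pairing of two maps `u, v` from a locale with frame of
opens `L` to the reals with a binary operation `op` on the reals. It is given by its inverse
image: the inverse image of `A × B` under the pairing is `u A ⊓ v B`. -/
def binop {L : Type} [Order.Frame L] (op : C(ℝ × ℝ, ℝ)) (u v : Opens ℝ → L) (U : Opens ℝ) : L :=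
  ⨆ (A : Opens ℝ) (B : Opens ℝ) (_ : ∀ a ∈ A, ∀ b ∈ B, op (a, b) ∈ U), u A ⊓ v B

/-- Subtraction as a map. -/
def subMap : C(ℝ × ℝ, ℝ) := ⟨fun p => p.1 - p.2, by fun_prop⟩

/-- Multiplication as a map. -/
def mulMap : C(ℝ × ℝ, ℝ) := ⟨fun p => p.1 * p.2, by fun_prop⟩

/-! Differentiation in the sense of Carathéodory, on an open `I` of the real line. -/

/-- `s` is a slope map for `f`: as maps `I × I → ℝ` in the variables `(x, y)`,
`f(y) - f(x) = (y - x) s(x, y)`. -/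
def IsSlope {I : Opens ℝ} (f : LMap I ℝ) (s : LMap (I × I) ℝ) : Prop :=
  binop subMap ((Opens.comap (ContinuousMap.snd : C(I × I, I))).comp f)
      ((Opens.comap (ContinuousMap.fst : C(I × I, I))).comp f) =
    binop mulMap
      (binop subMap (Opens.comap (⟨fun p => (p.2 : ℝ), by fun_prop⟩ : C(I × I, ℝ)))
        (Opens.comap (⟨fun p => (p.1 : ℝ), by fun_prop⟩ : C(I × I, ℝ))))
      s

/-- The restriction `x ↦ s(x, x)` of a map on `I × I` to the diagonal. -/
def diagonal {I : Opens ℝ} (s : LMap (I × I) ℝ) : LMap I ℝ :=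
  (Opens.comap ((ContinuousMap.id I).prodMk (ContinuousMap.id I))).comp s

/-- `f` is differentiable with derivative `f'` (in the sense of Carathéodory), and this is
witnessed by the slope map `s`. -/
def HasDerivativeVia {I : Opens ℝ} (f f' : LMap I ℝ) (s : LMap (I × I) ℝ) : Prop :=
  IsSlope f s ∧ diagonal s = f'

/-! Valuations and integrals on a locale with frame of opens `L`. Non-negative lower and upper
reals are elements of `ℝ≥0∞`. -/

section Integration

variable {L : Type} [Order.Frame L]

/-- Valuations: Scott continuous, strict and modular. -/
structure IsValuation (μ : L → ℝ≥0∞) : Prop where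
  scott : ScottContinuous μ
  map_bot : μ ⊥ = 0
  modular : ∀ U V : L, μ U + μ V = μ (U ⊔ V) + μ (U ⊓ V)

/-- Probability valuations. -/
structure IsProbabilityValuation (μ : L → ℝ≥0∞) : Prop extends IsValuation μ where
  map_top : μ ⊤ = 1

/-- The complement covaluation of a finite valuation: the mass of closed complements. -/
def compl (μ : L → ℝ≥0∞) (U : L) : ℝ≥0∞ := μ ⊤ - μ U

/-- Rational sequences `0 = r 0 < r 1 < ⋯ < r n`, with `1 ≤ n`. (The values of `r` after `n` are
irrelevant.) -/
def IsSubdivision (n : ℕ) (r : ℕ → ℚ≥0) : Prop :=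
  1 ≤ n ∧ r 0 = 0 ∧ ∀ i < n, r i < r (i + 1)

/-- The open `(q, ∞)` of `[0, ∞)`. -/
def above (q : ℚ≥0) : Opens ℝ≥0 := ⟨Set.Ioi (q : ℝ≥0), isOpen_Ioi⟩

/-- The open `[0, q)` of `[0, ∞)`. -/
def below (q : ℚ≥0) : Opens ℝ≥0 := ⟨Set.Iio (q : ℝ≥0), isOpen_Iio⟩

/-- The length `r (i + 1) - r i` of a step of a subdivision. -/
def step (r : ℕ → ℚ≥0) (i : ℕ) : ℝ≥0∞ := ((r (i + 1) : ℝ≥0) - (r i : ℝ≥0) : ℝ≥0)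

/-- The lower integral of (the lower part of) a map `φ` to `[0, ∞)` against a valuation. -/
def lowerIntegral (μ : L → ℝ≥0∞) (φ : FrameHom (Opens ℝ≥0) L) : ℝ≥0∞ :=
  ⨆ (n : ℕ) (r : ℕ → ℚ≥0) (_ : IsSubdivision n r),
    ∑ i ∈ Finset.range n, step r i * μ (φ (above (r (i + 1))))

/-- The upper integral of (the upper part of) a map `φ` to `[0, ∞)` against a covaluation. -/
def upperIntegral (ν : L → ℝ≥0∞) (φ : FrameHom (Opens ℝ≥0) L) : ℝ≥0∞ :=
  ⨅ (n : ℕ) (r : ℕ → ℚ≥0) (_ : IsSubdivision n r) (_ : φ (below (r n)) = ⊤),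
    ∑ i ∈ Finset.range n, step r i * ν (φ (below (r i)))

/-- The two-sided integral of a map `φ` to `[0, ∞)` is the (Dedekind) real `a`: the pair formed by
the lower integral against `μ` and the upper integral against the complement of `μ` is the
pair of the lower part and the upper part of `a`. -/
def IsIntegralNonneg (μ : L → ℝ≥0∞) (φ : FrameHom (Opens ℝ≥0) L) (a : ℝ≥0) : Prop :=
  lowerIntegral μ φ = a ∧ upperIntegral (compl μ) φ = a

/-- The positive part `max 0 φ` of a real-valued map. -/
def posPart (φ : FrameHom (Opens ℝ) L) : FrameHom (Opens ℝ≥0) L :=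
  φ.comp (Opens.comap ⟨fun t : ℝ => Real.toNNReal t, by fun_prop⟩)

/-- The negative part `max 0 (-φ)` of a real-valued map. -/
def negPart (φ : FrameHom (Opens ℝ) L) : FrameHom (Opens ℝ≥0) L :=
  φ.comp (Opens.comap ⟨fun t : ℝ => Real.toNNReal (-t), by fun_prop⟩)

/-- The two-sided integral of the real-valued map `φ` against `μ` exists and equals `a`. -/
def IsIntegral (μ : L → ℝ≥0∞) (φ : FrameHom (Opens ℝ) L) (a : ℝ) : Prop :=
  ∃ p n : ℝ≥0, IsIntegralNonneg μ (posPart φ) p ∧ IsIntegralNonneg μ (negPart φ) n ∧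
    a = (p : ℝ) - (n : ℝ)

end Integration

/-! Valuations on the compact interval `[x, y]`. -/

/-- The trace on `[x, y]` of the rational open interval `(a, b)`. -/
def trace (x y : ℝ) (a b : ℚ) : Opens (Set.Icc x y) :=
  ⟨{t | (a : ℝ) < t ∧ (t : ℝ) < b},
    (isOpen_lt continuous_const continuous_subtype_val).inter
      (isOpen_lt continuous_subtype_val continuous_const)⟩

/-- Extension to all opens of `[x, y]` of a mass function `m` on rational open intervals: the mass
of `U` is the supremum of the total masses of the finite families of pairwise disjoint rational
open intervals with trace contained in `U`. -/
def extend (x y : ℝ) (m : ℚ → ℚ → ℝ≥0∞) (U : Opens (Set.Icc x y)) : ℝ≥0∞ :=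
  ⨆ (S : Finset (ℚ × ℚ)) (_ : ∀ p ∈ S, p.1 < p.2 ∧ trace x y p.1 p.2 ≤ U)
    (_ : (S : Set (ℚ × ℚ)).PairwiseDisjoint (fun p => Set.Ioo p.1 p.2)),
    ∑ p ∈ S, m p.1 p.2

/-- The Lebesgue mass of `(a, b)` in `[x, y]`: the truncated difference of `min b y` and
`max a x`. -/
def lebesgueMass (x y : ℝ) (a b : ℚ) : ℝ≥0∞ :=
  ENNReal.ofReal (min (b : ℝ) y - max (a : ℝ) x)

/-- The Lebesgue valuation on `[x, y]`. -/
def lebesgue (x y : ℝ) : Opens (Set.Icc x y) → ℝ≥0∞ :=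
  extend x y (lebesgueMass x y)

/-- The uniform mass of `(a, b)` in `[x, y]`, for `x ≤ y`: the lower real whose non-negative rational
lower bounds are the `q` with `q (y - x) < λ(a, b)` or (`a < x`, `y < b` and `q < 1`). -/
def uniformMass (x y : ℝ) (a b : ℚ) : ℝ≥0∞ :=
  ⨆ (q : ℚ≥0) (_ : ((q : ℝ≥0) : ℝ≥0∞) * ENNReal.ofReal (y - x) < lebesgueMass x y a b ∨
      ((a : ℝ) < x ∧ y < b ∧ q < 1)), ((q : ℝ≥0) : ℝ≥0∞)

/-- The uniform probability valuation on `[x, y]`, including the case `x = y`. -/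
def uniform (x y : ℝ) : Opens (Set.Icc x y) → ℝ≥0∞ :=
  extend x y (uniformMass x y)

/-! Integrals of maps on an open interval `I`. -/

/-- The inclusion `[x, y] → I`, for points `x, y` of an interval `I`. -/
def inclusion {I : Opens ℝ} (hI : (I : Set ℝ).OrdConnected) (x y : I) :
    C(Set.Icc (x : ℝ) (y : ℝ), I) :=
  ⟨fun t => ⟨t, hI.out x.2 y.2 t.2⟩, by fun_prop⟩

/-- The restriction of a map on `I` to `[x, y]`. -/
def restrict {I : Opens ℝ} (hI : (I : Set ℝ).OrdConnected) (g : LMap I ℝ) (x y : I) :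
    LMap (Set.Icc (x : ℝ) (y : ℝ)) ℝ :=
  (Opens.comap (inclusion hI x y)).comp g

/-- The Riemann integral of `g` from `x` to `y` exists and equals `a`. It is the integral against the
Lebesgue valuation on `[x, y]` if `x ≤ y`, and the negative of that on `[y, x]` if `y ≤ x`. -/
def IsRiemannIntegral {I : Opens ℝ} (hI : (I : Set ℝ).OrdConnected) (g : LMap I ℝ) (x y : I)
    (a : ℝ) : Prop :=
  (x ≤ y → IsIntegral (lebesgue x y) (restrict hI g x y) a) ∧
    (y ≤ x → IsIntegral (lebesgue y x) (restrict hI g y x) (-a))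

/-- `f` is given on `I` by `f(x) = ∫_{x₀}^x g(t) dt`. -/
def IsIndefiniteIntegral {I : Opens ℝ} (hI : (I : Set ℝ).OrdConnected) (g : LMap I ℝ) (x₀ : I)
    (f : LMap I ℝ) : Prop :=
  ∀ x : I, ∃ a : ℝ, IsRiemannIntegral hI g x₀ x a ∧ f.HasValue x a

end PointFree

end

/-! Maps into the reals have values at all points and so are continuous functions, and the two
valuations on `[x, y]` are restrictions of measures to opens. A lower or upper sum of `φ` is the
integral of a step function of `φ`, close to `φ` for a fine subdivision, so point-free integrals are
integrals of continuous functions. The uniform measure `υ` on `[x, y]` is the image of Lebesgue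
measure on `[0, 1]` under `t ↦ x + t (y - x)`. Hence the mean `∫ g dυ` is continuous in `(x, y)`, it
is `g x` for `x = y`, and `(y - x) ∫ g dυ = ∫ g dλ` because `(y - x) υ = λ`. -/

open MeasureTheory

noncomputable section

namespace PointFree

section Points

variable {X Y : Type} [TopologicalSpace X] [TopologicalSpace Y]

/-- The closed set of all points of `Y` lying in no open whose inverse image under `f` misses `x`:
the closure of the value of `f` at `x`, when there is such a value. -/
def LMap.valueClosure (f : LMap X Y) (x : X) : Set Y := (sSup {U | x ∉ f U} : Opens Y)ᶜ

theorem LMap.mem_apply_iff_inter_nonempty (f : LMap X Y) (x : X) (U : Opens Y) :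
    x ∈ f U ↔ (f.valueClosure x ∩ U).Nonempty := by
  have notMem_sSup : x ∉ f (sSup {U | x ∉ f U}) := by
    simp only [map_sSup, Opens.mem_sSup, Set.mem_image]
    rintro ⟨_, ⟨V, hV, rfl⟩, hx⟩
    exact hV hx
  rw [LMap.valueClosure, Set.inter_comm, Set.inter_compl_nonempty_iff, SetLike.coe_subset_coe,
    iff_not_comm]
  exact ⟨fun hle hx => notMem_sSup (OrderHomClass.mono f hle hx), fun hx => le_sSup hx⟩

theorem LMap.isIrreducible_valueClosure (f : LMap X Y) (x : X) :
    IsIrreducible (f.valueClosure x) := by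
  constructor
  · have h : x ∈ f ⊤ := map_top f ▸ trivial
    exact ((f.mem_apply_iff_inter_nonempty x ⊤).1 h).left
  · intro U V hU hV hxU hxV
    lift U to Opens Y using hU
    lift V to Opens Y using hV
    rw [← LMap.mem_apply_iff_inter_nonempty] at hxU hxV
    rw [← Opens.coe_inf, ← LMap.mem_apply_iff_inter_nonempty, map_inf]
    exact ⟨hxU, hxV⟩

theorem LMap.exists_hasValue [QuasiSober Y] (f : LMap X Y) (x : X) : ∃ y, f.HasValue x y := by
  obtain ⟨y, hy⟩ := QuasiSober.sober (f.isIrreducible_valueClosure x)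
    (Opens.isOpen _).isClosed_compl
  exact ⟨y, fun U => by
    rw [f.mem_apply_iff_inter_nonempty, ← SetLike.mem_coe, hy.mem_open_set_iff U.isOpen]⟩

theorem comap_surjective [QuasiSober Y] :
    Function.Surjective (Opens.comap : C(X, Y) → LMap X Y) := by
  intro f
  choose F hF using LMap.exists_hasValue f
  have preimage_eq (U : Opens Y) : F ⁻¹' U = f U := Set.ext fun x => (hF x U).symm
  refine ⟨⟨F, ⟨fun s hs => ?_⟩⟩, FrameHom.ext fun U => Opens.ext (preimage_eq U)⟩
  exact preimage_eq ⟨s, hs⟩ ▸ (f ⟨s, hs⟩).isOpen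

theorem hasValue_comap_iff [T0Space Y] (F : C(X, Y)) (x : X) (y : Y) :
    LMap.HasValue (Opens.comap F) x y ↔ F x = y := by
  refine ⟨fun h => Inseparable.eq <| inseparable_iff_forall_isOpen.2 fun s hs => h ⟨s, hs⟩, ?_⟩
  rintro rfl U
  exact Iff.rfl

theorem binop_comap (op : C(ℝ × ℝ, ℝ)) (u v : C(X, ℝ)) :
    binop op (Opens.comap u) (Opens.comap v) = Opens.comap (op.comp (u.prodMk v)) := by
  ext U x
  simp only [binop, SetLike.mem_coe, Opens.mem_iSup]
  constructor
  · rintro ⟨A, B, hAB, hu, hv⟩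
    exact hAB _ hu _ hv
  · intro hx
    obtain ⟨A, B, hA, hB, hu, hv, hAB⟩ :=
      isOpen_prod_iff.1 (U.isOpen.preimage op.continuous) (u x) (v x) hx
    exact ⟨⟨A, hA⟩, ⟨B, hB⟩, fun a ha b hb => hAB (Set.mk_mem_prod ha hb), hu, hv⟩

end Points

section StepFunctions

open Filter Topology

/-- The step function below the identity of `[0, ∞)` which a subdivision `r 0 < ⋯ < r n` cuts out;
its composite with a map `φ` is what a lower sum integrates. -/
def lowerStep (n : ℕ) (r : ℕ → ℚ≥0) (t : ℝ≥0) : ℝ≥0∞ :=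
  ∑ i ∈ Finset.range n, (Set.Ioi (r (i + 1) : ℝ≥0)).indicator (fun _ => step r i) t

/-- The step function above the identity of `[0, r n)` which a subdivision `r 0 < ⋯ < r n` cuts out;
its composite with a map `φ` is what an upper sum integrates. -/
def upperStep (n : ℕ) (r : ℕ → ℚ≥0) (t : ℝ≥0) : ℝ≥0∞ :=
  ∑ i ∈ Finset.range n, (Set.Ici (r i : ℝ≥0)).indicator (fun _ => step r i) t

theorem measurable_lowerStep (n : ℕ) (r : ℕ → ℚ≥0) : Measurable (lowerStep n r) :=
  Finset.measurable_fun_sum _ fun _ _ => measurable_const.indicator measurableSet_Ioi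

variable {n : ℕ} {r : ℕ → ℚ≥0}

theorem step_eq_tsub (r : ℕ → ℚ≥0) (i : ℕ) :
    step r i = ((r (i + 1) : ℝ≥0) : ℝ≥0∞) - ((r i : ℝ≥0) : ℝ≥0∞) :=
  ENNReal.coe_sub

theorem coe_succ_le_add_of_step_le {ε : ℝ≥0∞} {i : ℕ} (hε : step r i ≤ ε) :
    ((r (i + 1) : ℝ≥0) : ℝ≥0∞) ≤ (r i : ℝ≥0) + ε := by
  rwa [step_eq_tsub, tsub_le_iff_left] at hε

theorem IsSubdivision.coe_le_coe_succ (hr : IsSubdivision n r) {i : ℕ}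
    (hi : i ∈ Finset.range n) : ((r i : ℝ≥0) : ℝ≥0∞) ≤ (r (i + 1) : ℝ≥0) := by
  exact_mod_cast (hr.2.2 i (Finset.mem_range.1 hi)).le

-- A step function is compared with the identity term by term along this telescoping sum.
theorem IsSubdivision.sum_min_tsub_min (hr : IsSubdivision n r) (s : ℝ≥0∞) :
    ∑ i ∈ Finset.range n, (min s (r (i + 1) : ℝ≥0) - min s (r i : ℝ≥0)) = min s (r n : ℝ≥0) := by
  have sum_eq : ∀ m ≤ n, ∑ i ∈ Finset.range m,
      (min s (r (i + 1) : ℝ≥0) - min s (r i : ℝ≥0)) = min s (r m : ℝ≥0) := by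
    intro m hm
    induction m with
    | zero => simp [hr.2.1]
    | succ m ih =>
      rw [Finset.sum_range_succ, ih (by omega), add_tsub_cancel_of_le]
      exact min_le_min_left s (hr.coe_le_coe_succ (Finset.mem_range.2 hm))
  exact sum_eq n le_rfl

theorem min_tsub_min_le (s a b : ℝ≥0∞) : min s b - min s a ≤ b - a := by
  rw [tsub_le_iff_left, ← min_add_add_right]
  exact min_le_min le_self_add le_add_tsub

theorem IsSubdivision.lowerStep_le (hr : IsSubdivision n r) (t : ℝ≥0) : lowerStep n r t ≤ t := by
  refine le_trans ?_ ((hr.sum_min_tsub_min t).trans_le (min_le_left _ _))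
  refine Finset.sum_le_sum fun i hi => Set.indicator_apply_le' (fun hit => ?_) fun _ => zero_le
  have hit : ((r (i + 1) : ℝ≥0) : ℝ≥0∞) ≤ t := ENNReal.coe_le_coe.2 (le_of_lt hit)
  rw [step_eq_tsub, min_eq_right hit, min_eq_right ((hr.coe_le_coe_succ hi).trans hit)]

theorem IsSubdivision.min_tsub_le_lowerStep (hr : IsSubdivision n r) {ε : ℝ≥0∞}
    (hε : ∀ i < n, step r i ≤ ε) (t : ℝ≥0) :
    min (t - ε) (r n : ℝ≥0) ≤ lowerStep n r t := by
  rw [← hr.sum_min_tsub_min]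
  refine Finset.sum_le_sum fun i hi => ?_
  by_cases hit : (r (i + 1) : ℝ≥0) < t
  · rw [Set.indicator_of_mem (Set.mem_Ioi.2 hit), step_eq_tsub]
    exact min_tsub_min_le _ _ _
  · have htr : (t : ℝ≥0∞) ≤ (r i : ℝ≥0) + ε :=
      (ENNReal.coe_le_coe.2 (not_lt.1 hit)).trans
        (coe_succ_le_add_of_step_le (hε i (Finset.mem_range.1 hi)))
    rw [min_eq_left (tsub_le_iff_right.2 htr), tsub_eq_zero_of_le (min_le_left _ _)]
    exact zero_le

theorem IsSubdivision.min_le_upperStep (hr : IsSubdivision n r) (t : ℝ≥0) :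
    min (t : ℝ≥0∞) (r n : ℝ≥0) ≤ upperStep n r t := by
  rw [← hr.sum_min_tsub_min]
  refine Finset.sum_le_sum fun i _ => ?_
  by_cases hit : (r i : ℝ≥0) ≤ t
  · rw [Set.indicator_of_mem (Set.mem_Ici.2 hit), step_eq_tsub]
    exact min_tsub_min_le _ _ _
  · rw [min_eq_left (ENNReal.coe_le_coe.2 (not_le.1 hit).le), tsub_eq_zero_of_le (min_le_left _ _)]
    exact zero_le

theorem IsSubdivision.upperStep_le_add (hr : IsSubdivision n r) {ε : ℝ≥0∞}
    (hε : ∀ i < n, step r i ≤ ε) (t : ℝ≥0) : upperStep n r t ≤ t + ε := by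
  refine le_trans ?_ ((hr.sum_min_tsub_min (t + ε)).trans_le (min_le_left _ _))
  refine Finset.sum_le_sum fun i hi => Set.indicator_apply_le' (fun hit => ?_) fun _ => zero_le
  have hit : ((r i : ℝ≥0) : ℝ≥0∞) ≤ t := ENNReal.coe_le_coe.2 hit
  have hit' : ((r (i + 1) : ℝ≥0) : ℝ≥0∞) ≤ t + ε :=
    (coe_succ_le_add_of_step_le (hε i (Finset.mem_range.1 hi))).trans (by gcongr)
  rw [step_eq_tsub, min_eq_right hit', min_eq_right (hit.trans le_self_add)]

/-- The points of the subdivision of `[0, k + 1]` into `(k + 1) ^ 2` steps of length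
`1 / (k + 1)`. -/
def grid (k i : ℕ) : ℚ≥0 := i / (k + 1)

theorem isSubdivision_grid (k : ℕ) : IsSubdivision ((k + 1) ^ 2) (grid k) := by
  refine ⟨Nat.one_le_pow _ _ k.succ_pos, by simp [grid], fun i _ => ?_⟩
  unfold grid
  gcongr
  exact i.lt_succ_self

theorem grid_sq (k : ℕ) : grid k ((k + 1) ^ 2) = k + 1 := by
  rw [grid]
  push_cast
  field_simp

theorem step_grid (k i : ℕ) : step (grid k) i = ((k + 1 : ℕ) : ℝ≥0∞)⁻¹ := by
  rw [step, grid, grid, ← ENNReal.coe_natCast, ← ENNReal.coe_inv (by positivity)]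
  congr 1
  push_cast
  rw [add_div, add_tsub_cancel_left, one_div]

theorem tendsto_inv_add_one : Tendsto (fun k : ℕ => ((k + 1 : ℕ) : ℝ≥0∞)⁻¹) atTop (𝓝 0) :=
  ENNReal.tendsto_inv_nat_nhds_zero.comp (tendsto_add_atTop_nat 1)

theorem le_liminf_lowerStep_grid (t : ℝ≥0) :
    (t : ℝ≥0∞) ≤ liminf (fun k => lowerStep ((k + 1) ^ 2) (grid k) t) atTop := by
  have tendsto_min : Tendsto (fun k : ℕ =>
      min (t - ((k + 1 : ℕ) : ℝ≥0∞)⁻¹) ((k + 1 : ℕ) : ℝ≥0∞)) atTop (𝓝 t) := by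
    simpa using (ENNReal.Tendsto.sub tendsto_const_nhds tendsto_inv_add_one
      (.inr ENNReal.zero_ne_top)).min (ENNReal.tendsto_nat_nhds_top.comp (tendsto_add_atTop_nat 1))
  refine tendsto_min.liminf_eq.ge.trans (liminf_le_liminf (.of_forall fun k => ?_))
  have := (isSubdivision_grid k).min_tsub_le_lowerStep (fun i _ => (step_grid k i).le) t
  rw [grid_sq] at this
  exact_mod_cast this

end StepFunctions

section Integrals

open Filter Topology

variable {X : Type} [TopologicalSpace X] [MeasurableSpace X]

/-- The mass function on opens given by a measure; it is through such mass functions that the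
valuations on `[x, y]` are compared with measures. -/
def ofMeasure (μ : Measure X) (U : Opens X) : ℝ≥0∞ := μ U

variable [OpensMeasurableSpace X] {μ : Measure X}

theorem isValuation_ofMeasure (hμ : μ.InnerRegularWRT IsCompact IsOpen) :
    IsValuation (ofMeasure μ) where
  scott := by
    intro d hne hd a ha
    obtain rfl : sSup d = a := (isLUB_sSup d).unique ha
    refine ⟨?_, fun b hb => le_of_forall_lt fun c hc => ?_⟩
    · rintro _ ⟨U, hU, rfl⟩
      exact measure_mono (le_sSup hU : U ≤ sSup d)
    · obtain ⟨K, hK, hKc, hcK⟩ := hμ (sSup d).isOpen c hc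
      have : Nonempty d := hne.to_subtype
      obtain ⟨U, hU⟩ := hKc.elim_directed_cover (fun U : d => (U : Set X))
        (fun U => U.1.isOpen) (fun x hx => by simpa using hK hx) hd.directed_val
      exact hcK.trans_le ((measure_mono hU).trans (hb ⟨U, U.2, rfl⟩))
  map_bot := measure_empty
  modular U V := (measure_union_add_inter _ V.isOpen.measurableSet).symm

theorem lower_sum_eq_lintegral (n : ℕ) (r : ℕ → ℚ≥0) (h : C(X, ℝ≥0)) :
    ∑ i ∈ Finset.range n, step r i * ofMeasure μ (Opens.comap h (above (r (i + 1)))) =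
      ∫⁻ x, lowerStep n r (h x) ∂μ := by
  have measurableSet_preimage (i : ℕ) : MeasurableSet (h ⁻¹' Set.Ioi (r (i + 1) : ℝ≥0)) :=
    h.continuous.measurable measurableSet_Ioi
  unfold lowerStep
  rw [lintegral_finsetSum]
  · exact Finset.sum_congr rfl fun i _ =>
      (lintegral_indicator_const (measurableSet_preimage i) _).symm
  · exact fun i _ => measurable_const.indicator (measurableSet_preimage i)

theorem upper_sum_eq_lintegral [IsFiniteMeasure μ] (n : ℕ) (r : ℕ → ℚ≥0) (h : C(X, ℝ≥0)) :
    ∑ i ∈ Finset.range n, step r i * compl (ofMeasure μ) (Opens.comap h (below (r i))) =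
      ∫⁻ x, upperStep n r (h x) ∂μ := by
  have measurableSet_preimage (i : ℕ) : MeasurableSet (h ⁻¹' Set.Ici (r i : ℝ≥0)) :=
    h.continuous.measurable measurableSet_Ici
  have compl_eq (i : ℕ) :
      compl (ofMeasure μ) (Opens.comap h (below (r i))) = μ (h ⁻¹' Set.Ici (r i : ℝ≥0)) := by
    rw [compl, ofMeasure, ofMeasure, Opens.coe_top,
      ← measure_compl (Opens.isOpen _).measurableSet (measure_ne_top _ _)]
    congr 1
    ext x
    exact not_lt (a := h x)
  unfold upperStep
  rw [lintegral_finsetSum]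
  · exact Finset.sum_congr rfl fun i _ => compl_eq i ▸
      (lintegral_indicator_const (measurableSet_preimage i) _).symm
  · exact fun i _ => measurable_const.indicator (measurableSet_preimage i)

theorem lowerIntegral_comap (μ : Measure X) (h : C(X, ℝ≥0)) :
    lowerIntegral (ofMeasure μ) (Opens.comap h) = ∫⁻ x, h x ∂μ := by
  simp only [lowerIntegral, lower_sum_eq_lintegral]
  apply le_antisymm
  · exact iSup_le fun n => iSup₂_le fun r hr => lintegral_mono fun x => hr.lowerStep_le (h x)
  · calc ∫⁻ x, h x ∂μ
        ≤ ∫⁻ x, liminf (fun k => lowerStep ((k + 1) ^ 2) (grid k) (h x)) atTop ∂μ :=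
          lintegral_mono fun x => le_liminf_lowerStep_grid (h x)
      _ ≤ liminf (fun k => ∫⁻ x, lowerStep ((k + 1) ^ 2) (grid k) (h x) ∂μ) atTop :=
          lintegral_liminf_le fun k => (measurable_lowerStep _ _).comp h.continuous.measurable
      _ ≤ _ := liminf_le_of_le (by isBoundedDefault) fun b hb => by
          obtain ⟨k, hk⟩ := hb.exists
          exact hk.trans (le_iSup_of_le _ (le_iSup₂_of_le _ (isSubdivision_grid k) le_rfl))

theorem upperIntegral_comap [IsFiniteMeasure μ] {h : C(X, ℝ≥0)}
    (hh : BddAbove (Set.range h)) :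
    upperIntegral (compl (ofMeasure μ)) (Opens.comap h) = ∫⁻ x, h x ∂μ := by
  simp only [upperIntegral, upper_sum_eq_lintegral]
  apply le_antisymm
  · obtain ⟨M, hM⟩ := hh
    have tendsto_integral : Tendsto (fun k : ℕ => ∫⁻ x, (h x + ((k + 1 : ℕ) : ℝ≥0∞)⁻¹) ∂μ) atTop
        (𝓝 (∫⁻ x, h x ∂μ)) := by
      simp_rw [lintegral_add_right _ measurable_const, lintegral_const]
      simpa using tendsto_const_nhds.add
        (ENNReal.Tendsto.mul_const tendsto_inv_add_one (.inr (measure_ne_top μ Set.univ)))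
    refine ge_of_tendsto tendsto_integral ?_
    filter_upwards [eventually_gt_atTop ⌈M⌉₊] with k hk
    have comap_below : Opens.comap h (below (grid k ((k + 1) ^ 2))) = ⊤ := by
      refine Opens.ext (Set.eq_univ_of_forall fun x => ?_)
      have hx : h x < k + 1 := calc
        h x ≤ ⌈M⌉₊ := (hM ⟨x, rfl⟩).trans (Nat.le_ceil M)
        _ < k + 1 := by exact_mod_cast hk.trans k.lt_succ_self
      change h x < (grid k ((k + 1) ^ 2) : ℝ≥0)
      rw [grid_sq]
      exact_mod_cast hx
    refine iInf_le_of_le _ (iInf₂_le_of_le _ (isSubdivision_grid k)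
      (iInf_le_of_le comap_below (lintegral_mono fun x => ?_)))
    exact (isSubdivision_grid k).upperStep_le_add (fun i _ => (step_grid k i).le) (h x)
  · refine le_iInf fun n => le_iInf₂ fun r hr => le_iInf fun htop => lintegral_mono fun x => ?_
    have hx : h x < r n := htop.ge (Opens.mem_top x)
    exact min_eq_left (ENNReal.coe_le_coe.2 hx.le) ▸ hr.min_le_upperStep (h x)

theorem isIntegralNonneg_comap_iff [IsFiniteMeasure μ] {h : C(X, ℝ≥0)}
    (hh : BddAbove (Set.range h)) (a : ℝ≥0) :
    IsIntegralNonneg (ofMeasure μ) (Opens.comap h) a ↔ ∫⁻ x, h x ∂μ = a := by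
  rw [IsIntegralNonneg, lowerIntegral_comap, upperIntegral_comap hh, and_self_iff]

theorem isIntegral_comap_iff [IsFiniteMeasure μ] [CompactSpace X] (k : C(X, ℝ)) (a : ℝ) :
    IsIntegral (ofMeasure μ) (Opens.comap k) a ↔ ∫ x, k x ∂μ = a := by
  have hk : Integrable k μ := k.continuous.integrable_of_hasCompactSupport
    (HasCompactSupport.of_compactSpace _)
  have posPart_eq : posPart (Opens.comap k) =
      Opens.comap ((⟨Real.toNNReal, by fun_prop⟩ : C(ℝ, ℝ≥0)).comp k) := rfl
  have negPart_eq : negPart (Opens.comap k) =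
      Opens.comap ((⟨fun t => Real.toNNReal (-t), by fun_prop⟩ : C(ℝ, ℝ≥0)).comp k) := rfl
  have bddAbove (h : C(X, ℝ≥0)) : BddAbove (Set.range h) := (isCompact_range h.continuous).bddAbove
  rw [integral_eq_lintegral_pos_part_sub_lintegral_neg_part hk, IsIntegral, posPart_eq, negPart_eq]
  simp only [isIntegralNonneg_comap_iff (bddAbove _), ContinuousMap.comp_apply,
    ContinuousMap.coe_mk, ENNReal.ofReal]
  constructor
  · rintro ⟨p, n, hp, hn, rfl⟩
    rw [hp, hn, ENNReal.coe_toReal, ENNReal.coe_toReal]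
  · rintro rfl
    exact ⟨_, _, (ENNReal.coe_toNNReal hk.lintegral_lt_top.ne).symm,
      (ENNReal.coe_toNNReal hk.neg.lintegral_lt_top.ne).symm, rfl⟩

end Integrals

section Segments

variable {E : Type*} [AddCommGroup E] [Module ℝ E] [TopologicalSpace E] [IsTopologicalAddGroup E]
  [ContinuousSMul ℝ E] {s : Set E}

/-- The point dividing the segment between two points of a convex set in the ratio `t : 1 - t`,
as a continuous function of these points and of `t`. -/
def segmentPoint (hs : Convex ℝ s) : C((s × s) × unitInterval, s) where
  toFun p := ⟨AffineMap.lineMap (p.1.1 : E) (p.1.2 : E) (p.2 : ℝ),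
    hs.lineMap_mem p.1.1.2 p.1.2.2 p.2.2⟩
  continuous_toFun := by
    simp only [AffineMap.lineMap_apply_module]
    fun_prop

theorem segmentPoint_self (hs : Convex ℝ s) (x : s) (t : unitInterval) :
    segmentPoint hs ((x, x), t) = x :=
  Subtype.ext (AffineMap.lineMap_same_apply _ _)

theorem segmentPoint_symm (hs : Convex ℝ s) (x y : s) (t : unitInterval) :
    segmentPoint hs ((x, y), unitInterval.symm t) = segmentPoint hs ((y, x), t) :=
  Subtype.ext (AffineMap.lineMap_apply_one_sub _ _ _)

end Segments

section Valuations

variable {x y : ℝ}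

theorem disjoint_trace {a b c d : ℚ} (h : Disjoint (Set.Ioo a b) (Set.Ioo c d)) :
    Disjoint (trace x y a b : Set (Set.Icc x y)) (trace x y c d) := by
  have hreal : Disjoint (Set.Ioo (a : ℝ) b) (Set.Ioo (c : ℝ) d) := by
    rw [Set.Ioo_disjoint_Ioo] at h ⊢
    exact_mod_cast h
  exact hreal.preimage ((↑) : Set.Icc x y → ℝ)

theorem trace_sup {a b c d : ℚ} (h : ¬Disjoint (Set.Ioo a b) (Set.Ioo c d)) :
    trace x y a b ⊔ trace x y c d = trace x y (min a c) (max b d) := by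
  obtain ⟨t, hab, hcd⟩ := Set.not_disjoint_iff.1 h
  have Ioo_union : Set.Ioo (a : ℝ) b ∪ Set.Ioo (c : ℝ) d =
      Set.Ioo ((min a c : ℚ) : ℝ) (max b d : ℚ) := by
    push_cast
    exact Set.Ioo_union_Ioo' (by exact_mod_cast hcd.1.trans hab.2)
      (by exact_mod_cast hab.1.trans hcd.2)
  exact Opens.ext (congrArg (((↑) : Set.Icc x y → ℝ) ⁻¹' ·) Ioo_union)

theorem exists_trace_le {U : Opens (Set.Icc x y)} {t : Set.Icc x y} (ht : t ∈ U) :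
    ∃ p : ℚ × ℚ, p.1 < p.2 ∧ trace x y p.1 p.2 ≤ U ∧ t ∈ trace x y p.1 p.2 := by
  obtain ⟨V, hV, hVU⟩ := isOpen_induced_iff.1 U.isOpen
  have htV : (t : ℝ) ∈ V := by
    rw [← Set.mem_preimage, hVU]
    exact ht
  obtain ⟨_, hW, htW, hWV⟩ := Real.isTopologicalBasis_Ioo_rat.exists_subset_of_mem_open htV hV
  simp only [Set.mem_iUnion, Set.mem_singleton_iff] at hW
  obtain ⟨a, b, hab, rfl⟩ := hW
  exact ⟨(a, b), hab, fun s hs => hVU.le (hWV hs), htW⟩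

/-- The traces of the rational open intervals in `S` lie in `U` and cover `K`. It is through such
covers that inner regularity of a measure bounds the suprema defining `extend` from below. -/
def IsTraceCover (K : Set (Set.Icc x y)) (U : Opens (Set.Icc x y)) (S : Finset (ℚ × ℚ)) : Prop :=
  (∀ p ∈ S, p.1 < p.2 ∧ trace x y p.1 p.2 ≤ U) ∧ K ⊆ ⋃ p ∈ S, trace x y p.1 p.2

variable {U : Opens (Set.Icc x y)} {K : Set (Set.Icc x y)}

theorem exists_isTraceCover (hK : IsCompact K) (hKU : K ⊆ U) :
    ∃ S : Finset (ℚ × ℚ), IsTraceCover K U S := by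
  obtain ⟨S, hS, hSfin, hKS⟩ := hK.elim_finite_subcover_image
    (b := {p : ℚ × ℚ | p.1 < p.2 ∧ trace x y p.1 p.2 ≤ U})
    (c := fun p => (trace x y p.1 p.2 : Set (Set.Icc x y))) (fun p _ => Opens.isOpen _)
    fun t ht => by
      obtain ⟨p, hp, hpU, htp⟩ := exists_trace_le (hKU ht)
      exact Set.mem_biUnion (show p ∈ {p : ℚ × ℚ | _} from ⟨hp, hpU⟩) htp
  lift S to Finset (ℚ × ℚ) using hSfin
  exact ⟨S, fun p hp => hS hp, hKS⟩

theorem IsTraceCover.exists_card_lt {S : Finset (ℚ × ℚ)} (h : IsTraceCover K U S) {p q : ℚ × ℚ}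
    (hp : p ∈ S) (hq : q ∈ S) (hpq : p ≠ q)
    (hdisj : ¬Disjoint (Set.Ioo p.1 p.2) (Set.Ioo q.1 q.2)) :
    ∃ T : Finset (ℚ × ℚ), IsTraceCover K U T ∧ T.card < S.card := by
  obtain ⟨hS, hKS⟩ := h
  have hq' : q ∈ S.erase p := Finset.mem_erase.2 ⟨hpq.symm, hq⟩
  have sup_eq := trace_sup (x := x) (y := y) hdisj
  refine ⟨insert (min p.1 q.1, max p.2 q.2) ((S.erase p).erase q), ⟨?_, ?_⟩, ?_⟩
  · rw [Finset.forall_mem_insert, ← sup_eq]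
    refine ⟨⟨(min_le_left _ _).trans_lt ((hS p hp).1.trans_le (le_max_left _ _)),
      sup_le (hS p hp).2 (hS q hq).2⟩, fun s hs => hS s ?_⟩
    exact Finset.mem_of_mem_erase (Finset.mem_of_mem_erase hs)
  · rwa [← Finset.insert_erase hp, ← Finset.insert_erase hq', Finset.set_biUnion_insert,
      Finset.set_biUnion_insert, ← Set.union_assoc, ← Opens.coe_sup, sup_eq,
      ← Finset.set_biUnion_insert (min p.1 q.1, max p.2 q.2)
        (t := fun p => (trace x y p.1 p.2 : Set (Set.Icc x y)))] at hKS
  · have := Finset.card_insert_le (min p.1 q.1, max p.2 q.2) ((S.erase p).erase q)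
    have := Finset.card_erase_lt_of_mem hq'
    have := Finset.card_erase_lt_of_mem hp
    omega

theorem exists_disjoint_isTraceCover (hK : IsCompact K) (hKU : K ⊆ U) :
    ∃ S : Finset (ℚ × ℚ), IsTraceCover K U S ∧
      (S : Set (ℚ × ℚ)).PairwiseDisjoint fun p => Set.Ioo p.1 p.2 := by
  -- In a cover with as few intervals as possible no two of them overlap, since their union would
  -- be a single interval.
  obtain ⟨S, hS, hmin⟩ := exists_minimalFor_of_wellFoundedLT (IsTraceCover K U) Finset.card
    (exists_isTraceCover hK hKU)
  refine ⟨S, hS, fun p hp q hq hpq => ?_⟩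
  by_contra hdisj
  obtain ⟨T, hT, hcard⟩ := hS.exists_card_lt hp hq hpq hdisj
  exact hcard.not_ge (hmin hT hcard.le)

theorem extend_measure_trace {ν : Measure (Set.Icc x y)}
    (hν : ν.InnerRegularWRT IsCompact IsOpen) :
    extend x y (fun a b => ν (trace x y a b)) = ofMeasure ν := by
  funext U
  apply le_antisymm
  · refine iSup₂_le fun S hS => iSup_le fun hdisj => ?_
    rw [← measure_biUnion_finset (fun p hp q hq hpq => disjoint_trace (hdisj hp hq hpq))
      fun p _ => (Opens.isOpen _).measurableSet]
    exact measure_mono (Set.iUnion₂_subset fun p hp => (hS p hp).2)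
  · refine le_of_forall_lt fun c hc => ?_
    obtain ⟨K, hKU, hK, hcK⟩ := hν U.isOpen c hc
    obtain ⟨S, ⟨hS, hKS⟩, hdisj⟩ := exists_disjoint_isTraceCover hK hKU
    have measure_le : ν K ≤ ∑ p ∈ S, ν (trace x y p.1 p.2) :=
      (measure_mono hKS).trans (measure_biUnion_finset_le S _)
    exact hcK.trans_le (le_iSup₂_of_le S hS (le_iSup_of_le hdisj measure_le))

/-- Lebesgue measure on the compact interval `[x, y]`. -/
def lebesgueMeasure (x y : ℝ) : Measure (Set.Icc x y) := Measure.comap (↑) (volume : Measure ℝ)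

theorem lebesgueMeasure_apply (s : Set (Set.Icc x y)) :
    lebesgueMeasure x y s = volume ((↑) '' s : Set ℝ) :=
  comap_subtype_coe_apply measurableSet_Icc volume s

theorem lebesgueMeasure_univ : lebesgueMeasure x y Set.univ = ENNReal.ofReal (y - x) := by
  rw [lebesgueMeasure_apply, Set.image_univ, Subtype.range_coe, Real.volume_Icc]

instance : IsFiniteMeasure (lebesgueMeasure x y) :=
  ⟨lebesgueMeasure_univ.trans_lt ENNReal.ofReal_lt_top⟩

theorem lebesgueMeasure_trace (a b : ℚ) :
    lebesgueMeasure x y (trace x y a b) = lebesgueMass x y a b := by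
  have image_trace : ((↑) '' (trace x y a b : Set (Set.Icc x y)) : Set ℝ) =
      Set.Ioo (a : ℝ) b ∩ Set.Icc x y := by
    rw [Set.inter_comm]
    exact Subtype.image_preimage_coe (Set.Icc x y) (Set.Ioo (a : ℝ) b)
  rw [lebesgueMeasure_apply, image_trace,
    measure_congr (Ioo_ae_eq_Icc.inter (Filter.EventuallyEq.refl _ (Set.Icc x y))),
    Set.Icc_inter_Icc, Real.volume_Icc]
  rfl

theorem lebesgue_eq_ofMeasure (x y : ℝ) : lebesgue x y = ofMeasure (lebesgueMeasure x y) := by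
  rw [lebesgue, ← extend_measure_trace Measure.Regular.innerRegular]
  simp_rw [lebesgueMeasure_trace]

theorem integral_lebesgueMeasure (hxy : x ≤ y) (k : ℝ → ℝ) :
    ∫ t, k t ∂lebesgueMeasure x y = ∫ t in x..y, k t := by
  rw [lebesgueMeasure, integral_subtype_comap measurableSet_Icc, integral_Icc_eq_integral_Ioc,
    intervalIntegral.integral_of_le hxy]

open scoped Pointwise in
theorem volume_lineMap_image (hxy : x ≤ y) (A : Set ℝ) :
    volume (AffineMap.lineMap x y '' A) = ENNReal.ofReal (y - x) * volume A := by
  have image_eq : AffineMap.lineMap x y '' A = x +ᵥ (y - x) • A := by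
    rw [← Set.image_smul, ← Set.image_vadd, Set.image_image]
    refine Set.image_congr' fun t => ?_
    rw [AffineMap.lineMap_apply_ring', smul_eq_mul, vadd_eq_add, mul_comm, add_comm]
  rw [image_eq, measure_vadd, Measure.addHaar_smul, Module.finrank_self, pow_one,
    abs_of_nonneg (sub_nonneg.2 hxy)]

/-- The affine parametrization of the compact interval `[x, y]`, constant if `x = y`. -/
def affineParam (hxy : x ≤ y) (t : unitInterval) : Set.Icc x y :=
  segmentPoint (convex_Icc x y)
    ((⟨x, Set.left_mem_Icc.2 hxy⟩, ⟨y, Set.right_mem_Icc.2 hxy⟩), t)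

theorem continuous_affineParam (hxy : x ≤ y) : Continuous (affineParam hxy) := by
  unfold affineParam
  fun_prop

theorem affineParam_surjective (hxy : x ≤ y) : Function.Surjective (affineParam hxy) := by
  rintro ⟨t, ht⟩
  rw [← segment_eq_Icc hxy, segment_eq_image_lineMap] at ht
  obtain ⟨r, hr, rfl⟩ := ht
  exact ⟨⟨r, hr⟩, rfl⟩

/-- The uniform probability measure on the compact interval `[x, y]`: the distribution of the point
dividing it in a uniformly distributed ratio. This makes sense also if `x = y`, where it is a Dirac
measure. -/
def uniformMeasure (hxy : x ≤ y) : Measure (Set.Icc x y) :=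
  Measure.map (affineParam hxy) volume

instance (hxy : x ≤ y) : IsProbabilityMeasure (uniformMeasure hxy) :=
  Measure.isProbabilityMeasure_map (continuous_affineParam hxy).aemeasurable

theorem integral_uniformMeasure (hxy : x ≤ y) (k : C(Set.Icc x y, ℝ)) :
    ∫ t, k t ∂uniformMeasure hxy = ∫ t : unitInterval, k (affineParam hxy t) :=
  integral_map (continuous_affineParam hxy).aemeasurable k.continuous.aestronglyMeasurable

theorem smul_uniformMeasure (hxy : x ≤ y) :
    ENNReal.ofReal (y - x) • uniformMeasure hxy = lebesgueMeasure x y := by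
  refine Measure.ext fun s hs => ?_
  have image_eq :
      (↑) '' s = AffineMap.lineMap x y '' ((↑) '' (affineParam hxy ⁻¹' s) : Set ℝ) := by
    conv_lhs => rw [← Set.image_preimage_eq s (affineParam_surjective hxy)]
    rw [Set.image_image, Set.image_image]
    rfl
  rw [Measure.smul_apply, uniformMeasure,
    Measure.map_apply (continuous_affineParam hxy).measurable hs, smul_eq_mul,
    unitInterval.volume_apply, lebesgueMeasure_apply, image_eq, volume_lineMap_image hxy]

theorem exists_nnrat_btwn {a b : ℝ≥0∞} (hab : a < b) :
    ∃ q : ℚ≥0, a < ((q : ℝ≥0) : ℝ≥0∞) ∧ ((q : ℝ≥0) : ℝ≥0∞) < b := by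
  obtain ⟨q, hq, haq, hqb⟩ := ENNReal.lt_iff_exists_rat_btwn.1 hab
  lift q to ℚ≥0 using hq
  have toNNReal_eq : Real.toNNReal (q : ℚ) = (q : ℝ≥0) := Real.toNNReal_coe (r := (q : ℝ≥0))
  exact ⟨q, toNNReal_eq ▸ haq, toNNReal_eq ▸ hqb⟩

theorem iSup_nnratCast_lt (c : ℝ≥0∞) :
    ⨆ (q : ℚ≥0) (_ : ((q : ℝ≥0) : ℝ≥0∞) < c), ((q : ℝ≥0) : ℝ≥0∞) = c := by
  refine le_antisymm (iSup₂_le fun q hq => hq.le) (le_of_forall_lt fun d hd => ?_)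
  obtain ⟨q, hdq, hqc⟩ := exists_nnrat_btwn hd
  exact hdq.trans_le (le_iSup₂_of_le q hqc le_rfl)

theorem lt_uniformMeasure_trace_iff (hxy : x ≤ y) (a b : ℚ) (q : ℝ≥0∞) :
    q < uniformMeasure hxy (trace x y a b) ↔
      q * ENNReal.ofReal (y - x) < lebesgueMass x y a b ∨ ((a : ℝ) < x ∧ y < b ∧ q < 1) := by
  rw [← lebesgueMeasure_trace, ← smul_uniformMeasure hxy, Measure.smul_apply, smul_eq_mul,
    mul_comm (ENNReal.ofReal _)]
  constructor
  · intro hq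
    obtain rfl | hlt := hxy.eq_or_lt
    · obtain ⟨t, ht⟩ := nonempty_of_measure_ne_zero hq.ne_bot
      exact .inr ⟨ht.1.trans_le t.2.2, ht.2.trans_le' t.2.1, hq.trans_le prob_le_one⟩
    · exact .inl (ENNReal.mul_lt_mul_left (by simpa using hlt) ENNReal.ofReal_ne_top hq)
  · rintro (hq | ⟨ha, hb, hq⟩)
    · exact lt_of_mul_lt_mul_right' hq
    · have trace_eq : (trace x y a b : Set (Set.Icc x y)) = Set.univ :=
        Set.eq_univ_of_forall fun t => ⟨ha.trans_le t.2.1, t.2.2.trans_lt hb⟩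
      rwa [trace_eq, measure_univ]

theorem uniformMass_eq (hxy : x ≤ y) (a b : ℚ) :
    uniformMass x y a b = uniformMeasure hxy (trace x y a b) := by
  rw [← iSup_nnratCast_lt (uniformMeasure hxy (trace x y a b))]
  simp only [uniformMass, lt_uniformMeasure_trace_iff, NNRat.cast_lt_one, ENNReal.coe_lt_one_iff]

theorem uniform_eq_ofMeasure (hxy : x ≤ y) : uniform x y = ofMeasure (uniformMeasure hxy) := by
  rw [uniform, ← extend_measure_trace Measure.Regular.innerRegular]
  simp_rw [← uniformMass_eq hxy]

theorem isProbabilityValuation_uniform (hxy : x ≤ y) : IsProbabilityValuation (uniform x y) := by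
  rw [uniform_eq_ofMeasure hxy]
  exact ⟨isValuation_ofMeasure Measure.Regular.innerRegular, measure_univ⟩

end Valuations

section FundamentalTheorem

variable {I : Opens ℝ} (hI : (I : Set ℝ).OrdConnected) (G : C(I, ℝ))

/-- The mean value of `G` between two points of `I`: the integral of `G` along the segment joining
them, with respect to its uniform parametrization. -/
def mean : C(I × I, ℝ) where
  toFun p := ∫ t : unitInterval, G (segmentPoint hI.convex (p, t))
  continuous_toFun := by
    have : LocallyCompactSpace I := I.isOpen.locallyCompactSpace
    have continuous_integrand : Continuous (Function.uncurry fun (p : I × I) (t : unitInterval) =>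
        G (segmentPoint hI.convex (p, t))) := by
      fun_prop
    simpa using continuous_parametric_integral_of_continuous (μ := volume) continuous_integrand
      isCompact_univ

theorem mean_apply (x y : I) :
    mean hI G (x, y) = ∫ t : unitInterval, G (segmentPoint hI.convex ((x, y), t)) :=
  rfl

theorem mean_self (x : I) : mean hI G (x, x) = G x := by
  have segment_self (t : unitInterval) : segmentPoint hI.convex ((x, x), t) = x :=
    segmentPoint_self hI.convex x t
  simp only [mean_apply, segment_self, integral_const, probReal_univ, one_smul]

theorem mean_swap (x y : I) : mean hI G (x, y) = mean hI G (y, x) := by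
  rw [mean_apply, mean_apply, ← unitInterval.measurePreserving_symm.integral_comp
    unitInterval.symmHomeomorph.measurableEmbedding]
  simp_rw [segmentPoint_symm]

theorem mean_min_max (x y : I) : mean hI G (min x y, max x y) = mean hI G (x, y) := by
  obtain h | h := le_total x y
  · rw [min_eq_left h, max_eq_right h]
  · rw [min_eq_right h, max_eq_left h, mean_swap]

/-- The extension by zero to `ℝ` of a continuous function on `I`, which makes the integrals over
different subintervals of `I` integrals of one function. -/
def zeroExtend : ℝ → ℝ := Function.extend (↑) G 0

theorem zeroExtend_coe (t : I) : zeroExtend G t = G t :=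
  Subtype.val_injective.extend_apply G 0 t

theorem continuousOn_zeroExtend : ContinuousOn (zeroExtend G) I := by
  rw [continuousOn_iff_continuous_domRestrict]
  exact G.continuous.congr fun t => (zeroExtend_coe G t).symm

theorem intervalIntegrable_zeroExtend (hI : (I : Set ℝ).OrdConnected) (x y : I) :
    IntervalIntegrable (zeroExtend G) volume x y :=
  ((continuousOn_zeroExtend G).mono (hI.uIcc_subset x.2 y.2)).intervalIntegrable

theorem isIntegral_restrict_iff {x y : I} (ν : Measure (Set.Icc (x : ℝ) y)) [IsFiniteMeasure ν]
    (a : ℝ) : IsIntegral (ofMeasure ν) (restrict hI (Opens.comap G) x y) a ↔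
      ∫ t, G (inclusion hI x y t) ∂ν = a := by
  have restrict_eq : restrict hI (Opens.comap G) x y = Opens.comap (G.comp (inclusion hI x y)) :=
    rfl
  rw [restrict_eq, isIntegral_comap_iff]
  rfl

theorem integral_inclusion_uniformMeasure {x y : I} (hxy : x ≤ y) :
    ∫ t, G (inclusion hI x y t) ∂uniformMeasure hxy = mean hI G (x, y) :=
  integral_uniformMeasure hxy (G.comp (inclusion hI x y))

theorem integral_inclusion_lebesgueMeasure {x y : I} (hxy : x ≤ y) :
    ∫ t, G (inclusion hI x y t) ∂lebesgueMeasure x y = ∫ t in (x : ℝ)..y, zeroExtend G t := by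
  rw [← integral_lebesgueMeasure hxy]
  exact integral_congr_ae (.of_forall fun t => (zeroExtend_coe G (inclusion hI x y t)).symm)

theorem isIntegral_uniform {x y : I} (hxy : x ≤ y) :
    IsIntegral (uniform x y) (restrict hI (Opens.comap G) x y) (mean hI G (x, y)) := by
  rw [uniform_eq_ofMeasure hxy, isIntegral_restrict_iff, integral_inclusion_uniformMeasure]

theorem sub_mul_mean (x y : I) :
    ((y : ℝ) - x) * mean hI G (x, y) = ∫ t in (x : ℝ)..y, zeroExtend G t := by
  wlog hxy : x ≤ y generalizing x y
  · rw [intervalIntegral.integral_symm, ← this y x (le_of_not_ge hxy), mean_swap, ← neg_mul,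
      neg_sub]
  have hxy' : (0 : ℝ) ≤ y - x := sub_nonneg.2 hxy
  rw [← integral_inclusion_lebesgueMeasure hI G hxy, ← smul_uniformMeasure hxy,
    integral_smul_measure, integral_inclusion_uniformMeasure, ENNReal.toReal_ofReal hxy',
    smul_eq_mul]

/-- The indefinite integral `x ↦ ∫_{x₀}^x G(t) dt`, as a continuous function. -/
def indefiniteIntegral (x₀ : I) : C(I, ℝ) where
  toFun x := ∫ t in (x₀ : ℝ)..x, zeroExtend G t
  continuous_toFun := by
    simp_rw [← sub_mul_mean hI]
    fun_prop

theorem indefiniteIntegral_sub (x₀ x y : I) :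
    indefiniteIntegral hI G x₀ y - indefiniteIntegral hI G x₀ x =
      ((y : ℝ) - x) * mean hI G (x, y) := by
  rw [sub_mul_mean]
  exact intervalIntegral.integral_interval_sub_left
    (intervalIntegrable_zeroExtend G hI x₀ y) (intervalIntegrable_zeroExtend G hI x₀ x)

theorem isIntegral_lebesgue_iff {x y : I} (hxy : x ≤ y) (a : ℝ) :
    IsIntegral (lebesgue x y) (restrict hI (Opens.comap G) x y) a ↔
      ∫ t in (x : ℝ)..y, zeroExtend G t = a := by
  rw [lebesgue_eq_ofMeasure, isIntegral_restrict_iff, integral_inclusion_lebesgueMeasure hI G hxy]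

theorem isRiemannIntegral_iff (x y : I) (a : ℝ) :
    IsRiemannIntegral hI (Opens.comap G) x y a ↔ ∫ t in (x : ℝ)..y, zeroExtend G t = a := by
  have integral_eq_neg_iff : ∫ t in (y : ℝ)..x, zeroExtend G t = -a ↔
      ∫ t in (x : ℝ)..y, zeroExtend G t = a := by
    rw [intervalIntegral.integral_symm, neg_inj]
  have forward (hxy : x ≤ y) := isIntegral_lebesgue_iff hI G hxy a
  have backward (hyx : y ≤ x) :=
    (isIntegral_lebesgue_iff hI G hyx (-a)).trans integral_eq_neg_iff
  rw [IsRiemannIntegral, imp_congr_right forward, imp_congr_right backward, ← or_imp,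
    imp_iff_right (le_total x y)]

theorem isIndefiniteIntegral_iff (x₀ : I) (f : LMap I ℝ) :
    IsIndefiniteIntegral hI (Opens.comap G) x₀ f ↔
      f = Opens.comap (indefiniteIntegral hI G x₀) := by
  obtain ⟨F, rfl⟩ := comap_surjective f
  simp only [IsIndefiniteIntegral, isRiemannIntegral_iff, hasValue_comap_iff, exists_eq_left',
    Opens.comap_injective.eq_iff, ContinuousMap.ext_iff]
  rfl

theorem hasDerivativeVia_mean (x₀ : I) :
    HasDerivativeVia (Opens.comap (indefiniteIntegral hI G x₀)) (Opens.comap G)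
      (Opens.comap (mean hI G)) := by
  constructor
  · rw [IsSlope, ← Opens.comap_comp, ← Opens.comap_comp, binop_comap, binop_comap, binop_comap]
    congr 2
    ext ⟨x, y⟩
    exact indefiniteIntegral_sub hI G x₀ x y
  · rw [diagonal, ← Opens.comap_comp]
    congr 1
    ext x
    exact mean_self hI G x

end FundamentalTheorem

end PointFree

end

theorem theorem4p1 (I : TopologicalSpace.Opens ℝ) (hI : (I : Set ℝ).OrdConnected)
    (g : PointFree.LMap I ℝ) (x₀ : I) :
    (∃! f : PointFree.LMap I ℝ, PointFree.IsIndefiniteIntegral hI g x₀ f) ∧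
    ∀ f : PointFree.LMap I ℝ, PointFree.IsIndefiniteIntegral hI g x₀ f →
      ∃ s : PointFree.LMap (I × I) ℝ,
        PointFree.HasDerivativeVia f g s ∧
        ∀ x y : I,
          PointFree.IsProbabilityValuation
            (PointFree.uniform (min x y : I) (max x y : I)) ∧
          ∃ a : ℝ,
            PointFree.IsIntegral (PointFree.uniform (min x y : I) (max x y : I))
              (PointFree.restrict hI g (min x y) (max x y)) a ∧
            s.HasValue (x, y) a := by
  obtain ⟨G, rfl⟩ := PointFree.comap_surjective g
  simp only [PointFree.isIndefiniteIntegral_iff]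
  refine ⟨⟨_, rfl, fun f hf => hf⟩, ?_⟩
  rintro f rfl
  refine ⟨_, PointFree.hasDerivativeVia_mean hI G x₀, fun x y => ?_⟩
  have hle : min x y ≤ max x y := min_le_max
  refine ⟨PointFree.isProbabilityValuation_uniform hle, _, PointFree.isIntegral_uniform hI G hle,
    ?_⟩
  rw [PointFree.hasValue_comap_iff, PointFree.mean_min_max]
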